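/- Corollary ($\mathrm{C}^nU$ with $U^2=I$, one dirty ancilla). A circuit over $\mathcal B_2$ is a sequence of gates, each of which is either an arbitrary single-qubit unitary or a CNOT gate, arranged in layers such that the gates of one layer act on pairwise disjoint sets of qubits. Its size is the number of its gates and its depth is the number of its layers. The gate $\mathrm{C}^nU$ acts on $n$ control qubits and one target qubit and applies $U$ to the target if and only if all $n$ controls are in state $|1\rangle$; the $n$-Toffoli gate is the map $|x_1,\dots,x_n,t\rangle\mapsto|x_1,\dots,x_n,t\oplus\bigwedge_{i=1}^n x_i\rangle$. A circuit on the $n+1$ qubits of a gate $V$ and one additional qubit implements $V$ with one dirty ancillary qubit if it maps $|\psi\rangle\otimes|a\rangle$ to $V|\psi\rangle\otimes|a\rangle$ for every state $|\psi\rangle$ of the $n+1$ qubits and every initial state $|a\rangle$ of the additional qubit. There is an absolute constant $K$ such that for every single-qubit unitary $U$ with $U^2=I$ and every $n\ge 1$, the gate $\mathrm{C}^nU$ can be implemented exactly, with one dirty ancillary qubit, by a circuit over $\mathcal B_2$ of size at most $Kn$ and, when $n\ge 2$, of depth at most $K\log n$. The same holds for the $n$-Toffoli gate. -/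

import Mathlib

open scoped Matrix

/-- Computational basis labels of a register of qubits indexed by `ι`. -/
abbrev Bits (ι : Type) : Type := ι → Fin 2

/-- (Not necessarily normalised) state vectors of the register `ι`. -/
abbrev QState (ι : Type) : Type := Bits ι → ℂ

/-- Operators on the state space of the register `ι`, as matrices in the computational basis
(row index: output, column index: input). -/
abbrev QOp (ι : Type) : Type := Matrix (Bits ι) (Bits ι) ℂ

/-- The gate set of all single-qubit unitaries and CNOT gates, placed on the qubits `ι`. -/
inductive QGate (ι : Type) : Type where
  | single (U : Matrix.unitaryGroup (Fin 2) ℂ) (q : ι) : QGate ι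
  | cnot (control target : ι) (hne : control ≠ target) : QGate ι

namespace QGate

/-- The qubits on which a gate acts. -/
def support {ι : Type} : QGate ι → Set ι
  | single _ q => {q}
  | cnot c t _ => {c, t}

/-- The operator of a gate on the whole register: `U` on qubit `q` and the identity elsewhere,
respectively the basis permutation `x_t ↦ x_t ⊕ x_c` (addition in `Fin 2` is modulo 2). -/
def op {ι : Type} [Fintype ι] [DecidableEq ι] : QGate ι → QOp ι
  | single U q => Matrix.of fun y x =>
      if ∀ j, j ≠ q → y j = x j then (U : Matrix (Fin 2) (Fin 2) ℂ) (y q) (x q) else 0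
  | cnot c t _ => Matrix.of fun y x => if y = Function.update x t (x t + x c) then 1 else 0

end QGate

/-- A quantum circuit on the qubits `ι`: a sequence of layers (first layer applied first), each of
them a collection of gates that act on pairwise disjoint sets of qubits. -/
structure QCircuit (ι : Type) : Type where
  layers : List (List (QGate ι))
  disjoint : ∀ L ∈ layers, L.Pairwise fun g h => Disjoint g.support h.support

namespace QCircuit

/-- All gates of the circuit, in temporal order. -/
def gates {ι : Type} (C : QCircuit ι) : List (QGate ι) := C.layers.flatten

/-- The number of gates. -/
def size {ι : Type} (C : QCircuit ι) : ℕ := C.gates.length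

/-- The number of layers. -/
def depth {ι : Type} (C : QCircuit ι) : ℕ := C.layers.length

/-- The operator computed by the circuit; later gates multiply from the left. -/
def op {ι : Type} [Fintype ι] [DecidableEq ι] (C : QCircuit ι) : QOp ι :=
  C.gates.foldl (fun M g => g.op * M) 1

end QCircuit

/-- The product state `ψ ⊗ φ` of two registers. -/
def tensorState {ι κ : Type} (ψ : QState ι) (φ : QState κ) : QState (ι ⊕ κ) :=
  fun z => ψ (fun i => z (Sum.inl i)) * φ (fun k => z (Sum.inr k))

/-- The circuit `C` implements `V` on the register `ι` with the dirty ancillary register `κ`: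
whatever the initial state `φ` of the ancillary qubits, `V` is applied to `ι` and the ancillary
qubits are returned to `φ`. -/
def ImplementsWithDirty {ι κ : Type} [Fintype ι] [DecidableEq ι] [Fintype κ] [DecidableEq κ]
    (C : QCircuit (ι ⊕ κ)) (V : QOp ι) : Prop :=
  ∀ (ψ : QState ι) (φ : QState κ), C.op *ᵥ tensorState ψ φ = tensorState (V *ᵥ ψ) φ

/-- The `n`-controlled `U` gate: qubits `0, …, n - 1` are the controls, qubit `n` is the target;
`U` is applied to the target if and only if all controls are `1`. -/
def controlledGate (n : ℕ) (U : Matrix (Fin 2) (Fin 2) ℂ) : QOp (Fin (n + 1)) := Matrix.of fun y x =>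
  if ∀ i : Fin n, x i.castSucc = 1 then
    if ∀ i : Fin n, y i.castSucc = x i.castSucc then U (y (Fin.last n)) (x (Fin.last n)) else 0
  else if y = x then 1 else 0

/-- The `n`-Toffoli gate `|x₁, …, xₙ, t⟩ ↦ |x₁, …, xₙ, t ⊕ (x₁ ∧ ⋯ ∧ xₙ)⟩`. -/
def toffoliGate (n : ℕ) : QOp (Fin (n + 1)) := Matrix.of fun y x =>
  if y = Function.update x (Fin.last n)
      (x (Fin.last n) + if ∀ i : Fin n, x i.castSucc = 1 then 1 else 0) then 1 else 0

/-! The task is to form the conjunction of n controls in logarithmic depth without clean workspace.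
If a bit p is known to be 1, the reversible map p ↦ p + 1 + qr writes qr into p. If moreover qr = 1
is demanded later, then q and r are themselves known to be 1 and can absorb further bits. Bits
already absorbed are thus conditionally clean workspace.

`Reduction` makes this precise: if x_z = 1 and the output of e is 1 on the few bits of Q, then x is
1 on all of R. `PreservesOnes` gives the converse and shows that under the same condition every
output bit of the block, read or not, is 1. In `Reduction.compose`, two of the unread bits start
reductions of two halves of the remaining bits in parallel, and other unread bits serve to merge the
two results into one. In `reduction_of_card_le_two_pow` each doubling of the block costs constant
depth and at most five bits remain; every merge is charged to a fixed number of newly absorbed bits,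
so the size is linear.

The conjunction over the block is now x_z · ∏_Q (e x)_q. In `Reduction.realizes_controlled_not` a
constant-size controlled NOT with controls Q and the dirty bit a is conjugated by e and used twice,
with x_z added to a in between; the contribution of the unknown value of a cancels.

Finally, a unitary involution has eigenvalues ±1 and is a conjugate of NOT or a product of two such
conjugates (`exists_conj_of_sq_eq_one`). Conjugation costs only single-qubit gates on the target. -/

/-! ### Parallel composition of layered circuits. -/

section Layers

variable {ι : Type}

/-- Two layered circuits run side by side. -/
def parLayers : List (List (QGate ι)) → List (List (QGate ι)) → List (List (QGate ι))
  | [], M => M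
  | L, [] => L
  | a :: L, b :: M => (a ++ b) :: parLayers L M

theorem length_parLayers (L M : List (List (QGate ι))) :
    (parLayers L M).length = max L.length M.length := by
  induction L generalizing M with
  | nil => simp [parLayers]
  | cons a L ih =>
    cases M with
    | nil => simp [parLayers]
    | cons b M => simp [parLayers, ih]

theorem perm_flatten_parLayers (L M : List (List (QGate ι))) :
    (parLayers L M).flatten.Perm (L.flatten ++ M.flatten) := by
  induction L generalizing M with
  | nil => simp [parLayers]
  | cons a L ih =>
    cases M with
    | nil => simp [parLayers]
    | cons b M =>
      simp only [parLayers, List.flatten_cons, List.append_assoc]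
      refine List.Perm.append_left a ?_
      refine ((ih M).append_left b).trans ?_
      rw [← List.append_assoc, ← List.append_assoc]
      exact List.perm_append_comm.append_right _

theorem pairwise_parLayers {L M : List (List (QGate ι))}
    (hL : ∀ l ∈ L, l.Pairwise fun g h => Disjoint g.support h.support)
    (hM : ∀ l ∈ M, l.Pairwise fun g h => Disjoint g.support h.support)
    (hLM : ∀ g ∈ L.flatten, ∀ h ∈ M.flatten, Disjoint g.support h.support) :
    ∀ l ∈ parLayers L M, l.Pairwise fun g h => Disjoint g.support h.support := by
  induction L generalizing M with
  | nil => simpa [parLayers] using hM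
  | cons a L ih =>
    cases M with
    | nil => simpa [parLayers] using hL
    | cons b M =>
      intro l hl
      simp only [parLayers, List.mem_cons] at hl
      rcases hl with rfl | hl
      · rw [List.pairwise_append]
        exact ⟨hL a (by simp), hM b (by simp), fun g hg h hh => hLM g (by simp [hg]) h (by simp [hh])⟩
      · refine ih (fun l hl => hL l (by simp [hl])) (fun l hl => hM l (by simp [hl])) ?_ l hl
        intro g hg h hh
        exact hLM g (by rw [List.flatten_cons]; exact List.mem_append_right _ hg) h
          (by rw [List.flatten_cons]; exact List.mem_append_right _ hh)

end Layers

/-! ### Action of gates on states, commutation, and cost of circuits. -/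

section Gates

variable {ι : Type} [Fintype ι] [DecidableEq ι]

theorem QGate.single_op_mulVec (U : Matrix.unitaryGroup (Fin 2) ℂ) (q : ι) (ψ : QState ι)
    (y : Bits ι) :
    ((QGate.single U q).op *ᵥ ψ) y =
      ∑ b : Fin 2, (U : Matrix (Fin 2) (Fin 2) ℂ) (y q) b * ψ (Function.update y q b) := by
  simp only [Matrix.mulVec, dotProduct, QGate.op, Matrix.of_apply, ite_mul, zero_mul]
  symm
  apply Finset.sum_of_injOn (fun b => Function.update y q b)
  · intro b _ b' _ h
    simpa using congrFun h q
  · intro b _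
    simp
  · intro x _ hx
    rw [if_neg]
    intro h
    apply hx
    refine ⟨x q, by simp, ?_⟩
    funext j
    by_cases hj : j = q
    · subst hj; simp
    · simp [hj, h j hj]
  · intro b _
    rw [if_pos]
    · simp
    · intro j hj
      simp [hj]

theorem QGate.cnot_op_mulVec (c t : ι) (h : c ≠ t) (ψ : QState ι) (y : Bits ι) :
    ((QGate.cnot c t h).op *ᵥ ψ) y = ψ (Function.update y t (y t + y c)) := by
  simp only [Matrix.mulVec, dotProduct, QGate.op, Matrix.of_apply, ite_mul, zero_mul, one_mul]
  have key : ∀ x : Bits ι, y = Function.update x t (x t + x c) ↔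
      x = Function.update y t (y t + y c) := by
    have two : ∀ a b : Fin 2, a + b + b = a := by decide
    intro x
    constructor <;> rintro rfl <;> simp [h, two]
  simp [key]

theorem QOp.ext_mulVec {A B : QOp ι} (h : ∀ ψ y, (A *ᵥ ψ) y = (B *ᵥ ψ) y) : A = B :=
  Matrix.ext_of_mulVec_single fun _ => funext fun y => h _ y

theorem QGate.op_comm (g h : QGate ι) (hd : Disjoint g.support h.support) :
    Commute g.op h.op := by
  apply QOp.ext_mulVec
  intro ψ y
  rw [← Matrix.mulVec_mulVec, ← Matrix.mulVec_mulVec]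
  cases g with
  | single U q =>
    cases h with
    | single V r =>
      have hqr : q ≠ r := by simpa [QGate.support] using hd
      simp only [QGate.single_op_mulVec, Function.update_of_ne hqr, Function.update_of_ne hqr.symm,
        Fin.sum_univ_two, Function.update_comm hqr]
      ring
    | cnot c t hne =>
      have hq : q ≠ c ∧ q ≠ t := by simpa [QGate.support] using hd
      simp [QGate.single_op_mulVec, QGate.cnot_op_mulVec, hq.2, hq.1.symm, hq.2.symm,
        Function.update_comm hq.2]
  | cnot c t hne =>
    cases h with
    | single V r =>
      have hr : c ≠ r ∧ t ≠ r := by simpa [QGate.support, eq_comm] using hd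
      simp [QGate.single_op_mulVec, QGate.cnot_op_mulVec, hr.1, hr.2, hr.2.symm,
        Function.update_comm hr.2]
    | cnot c' t' hne' =>
      have hr : (c ≠ c' ∧ t ≠ c') ∧ (c ≠ t' ∧ t ≠ t') := by
        simpa [QGate.support, Set.disjoint_insert_right, and_comm, and_assoc, and_left_comm,
          eq_comm] using hd
      obtain ⟨⟨h1, h2⟩, h3, h4⟩ := hr
      simp [QGate.cnot_op_mulVec, h3, h4, h4.symm, h2.symm,
        Function.update_comm h4]

/-- The operator of a sequence of gates, the first gate being applied first. -/
def gatesOp (l : List (QGate ι)) : QOp ι := l.foldl (fun M g => g.op * M) 1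

theorem foldl_op_eq (l : List (QGate ι)) (A : QOp ι) :
    l.foldl (fun M g => g.op * M) A = gatesOp l * A := by
  induction l generalizing A with
  | nil => simp [gatesOp]
  | cons g l ih =>
    simp only [gatesOp, List.foldl_cons] at ih ⊢
    rw [ih, ih (g.op * 1), mul_one, Matrix.mul_assoc]

@[simp] theorem gatesOp_nil : gatesOp ([] : List (QGate ι)) = 1 := rfl

theorem gatesOp_cons (g : QGate ι) (l : List (QGate ι)) :
    gatesOp (g :: l) = gatesOp l * g.op := by
  rw [gatesOp, List.foldl_cons, foldl_op_eq, mul_one]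

theorem gatesOp_append (l l' : List (QGate ι)) : gatesOp (l ++ l') = gatesOp l' * gatesOp l := by
  induction l with
  | nil => simp
  | cons g l ih => rw [List.cons_append, gatesOp_cons, ih, gatesOp_cons, Matrix.mul_assoc]

theorem gatesOp_commute {l l' : List (QGate ι)}
    (h : ∀ g ∈ l, ∀ g' ∈ l', Disjoint g.support g'.support) :
    Commute (gatesOp l) (gatesOp l') := by
  induction l with
  | nil => simp
  | cons g l ih =>
    rw [gatesOp_cons]
    refine Commute.mul_left (ih fun a ha => h a (by simp [ha])) ?_
    have h' := h g (by simp)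
    clear h ih
    induction l' with
    | nil => simp
    | cons g' l' ih =>
      rw [gatesOp_cons]
      exact Commute.mul_right (ih fun a ha => h' a (by simp [ha])) (QGate.op_comm _ _ (h' g' (by simp)))

/-- Interleaving the layers moves gates of one circuit only past gates of the other; these have
disjoint supports and so commute. -/
theorem gatesOp_parLayers {L M : List (List (QGate ι))}
    (hLM : ∀ g ∈ L.flatten, ∀ h ∈ M.flatten, Disjoint g.support h.support) :
    gatesOp (parLayers L M).flatten = gatesOp M.flatten * gatesOp L.flatten := by
  induction L generalizing M with
  | nil => simp [parLayers]
  | cons a L ih =>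
    cases M with
    | nil => simp [parLayers]
    | cons b M =>
      have hc : Commute (gatesOp L.flatten) (gatesOp b) := gatesOp_commute fun g hg h hh =>
        hLM g (by rw [List.flatten_cons]; exact List.mem_append_right _ hg) h
          (by rw [List.flatten_cons]; exact List.mem_append_left _ hh)
      simp only [parLayers, List.flatten_cons, gatesOp_append]
      rw [ih]
      · rw [Matrix.mul_assoc, Matrix.mul_assoc, ← Matrix.mul_assoc _ (gatesOp b), hc.eq]
        simp only [Matrix.mul_assoc]
      · intro g hg h hh
        exact hLM g (by rw [List.flatten_cons]; exact List.mem_append_right _ hg) h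
          (by rw [List.flatten_cons]; exact List.mem_append_right _ hh)

/-- The operator `A` is computed by a circuit of depth at most `d` and size at most `s` all of whose
gates act inside `S`. -/
def Realizes (S : Set ι) (d s : ℕ) (A : QOp ι) : Prop :=
  ∃ C : QCircuit ι, C.depth ≤ d ∧ C.size ≤ s ∧ (∀ g ∈ C.gates, g.support ⊆ S) ∧ C.op = A

namespace Realizes

variable {S S' : Set ι} {d d' s s' : ℕ} {A A' : QOp ι}

theorem mono (h : Realizes S d s A) (hS : S ⊆ S') (hd : d ≤ d') (hs : s ≤ s') :
    Realizes S' d' s' A := by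
  obtain ⟨C, h1, h2, h3, h4⟩ := h
  exact ⟨C, h1.trans hd, h2.trans hs, fun g hg => (h3 g hg).trans hS, h4⟩

theorem one : Realizes S 0 0 (1 : QOp ι) :=
  ⟨⟨[], by simp⟩, by simp [QCircuit.depth], by simp [QCircuit.size, QCircuit.gates],
    by simp [QCircuit.gates], rfl⟩

theorem gate (g : QGate ι) (hg : g.support ⊆ S) : Realizes S 1 1 g.op :=
  ⟨⟨[[g]], by simp⟩, by simp [QCircuit.depth], by simp [QCircuit.size, QCircuit.gates],
    by simpa [QCircuit.gates] using hg, by simp [QCircuit.op, QCircuit.gates]⟩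

theorem seq (h : Realizes S d s A) (h' : Realizes S d' s' A') :
    Realizes S (d + d') (s + s') (A' * A) := by
  obtain ⟨C, h1, h2, h3, h4⟩ := h
  obtain ⟨C', h1', h2', h3', h4'⟩ := h'
  have hg : (C.layers ++ C'.layers).flatten = C.gates ++ C'.gates := List.flatten_append
  refine ⟨⟨C.layers ++ C'.layers, ?_⟩, ?_, ?_, ?_, ?_⟩
  · intro L hL
    rcases List.mem_append.1 hL with hL | hL
    exacts [C.disjoint L hL, C'.disjoint L hL]
  · simp only [QCircuit.depth, List.length_append] at *
    omega
  · simp only [QCircuit.size, QCircuit.gates] at *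
    rw [hg, List.length_append]
    exact Nat.add_le_add h2 h2'
  · intro g hgm
    simp only [QCircuit.gates] at *
    rw [hg, List.mem_append] at hgm
    rcases hgm with hgm | hgm
    exacts [h3 g hgm, h3' g hgm]
  · rw [← h4, ← h4']
    change gatesOp (C.layers ++ C'.layers).flatten = gatesOp C'.gates * gatesOp C.gates
    rw [hg, gatesOp_append]

theorem par (h : Realizes S d s A) (h' : Realizes S' d s' A') (hS : Disjoint S S') :
    Realizes (S ∪ S') d (s + s') (A' * A) := by
  obtain ⟨C, h1, h2, h3, h4⟩ := h
  obtain ⟨C', h1', h2', h3', h4'⟩ := h'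
  have hdis : ∀ g ∈ C.layers.flatten, ∀ h ∈ C'.layers.flatten, Disjoint g.support h.support :=
    fun g hg h hh => hS.mono (h3 g hg) (h3' h hh)
  have hp := perm_flatten_parLayers C.layers C'.layers
  refine ⟨⟨parLayers C.layers C'.layers, pairwise_parLayers C.disjoint C'.disjoint hdis⟩,
    ?_, ?_, ?_, ?_⟩
  · simp only [QCircuit.depth, length_parLayers] at *
    omega
  · simp only [QCircuit.size, QCircuit.gates] at *
    rw [hp.length_eq, List.length_append]
    omega
  · intro g hg
    simp only [QCircuit.gates] at *
    rw [hp.mem_iff, List.mem_append] at hg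
    rcases hg with hg | hg
    · exact (h3 g hg).trans Set.subset_union_left
    · exact (h3' g hg).trans Set.subset_union_right
  · rw [← h4, ← h4']
    exact gatesOp_parLayers hdis

end Realizes

end Gates

/-! ### Classical reversible maps as operators. -/

section Classical

variable {ι : Type} [Fintype ι] [DecidableEq ι]

/-- The operator of a permutation of the basis labels. -/
def permOp (e : Equiv.Perm (Bits ι)) : QOp ι := Matrix.of fun y x => if y = e x then 1 else 0

theorem permOp_mulVec (e : Equiv.Perm (Bits ι)) (ψ : QState ι) (y : Bits ι) :
    (permOp e *ᵥ ψ) y = ψ (e.symm y) := by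
  simp only [Matrix.mulVec, dotProduct, permOp, Matrix.of_apply, ite_mul, zero_mul, one_mul]
  have : ∀ x, y = e x ↔ x = e.symm y := fun x => by rw [Equiv.eq_symm_apply, eq_comm]
  simp [this]

theorem permOp_mul (e f : Equiv.Perm (Bits ι)) : permOp (e * f) = permOp e * permOp f := by
  apply QOp.ext_mulVec
  intro ψ y
  rw [← Matrix.mulVec_mulVec, permOp_mulVec, permOp_mulVec, permOp_mulVec]
  rfl

theorem permOp_one : permOp (1 : Equiv.Perm (Bits ι)) = 1 := by
  apply QOp.ext_mulVec
  intro ψ y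
  rw [permOp_mulVec, Matrix.one_mulVec]
  rfl

theorem fin_two_add_add_self : ∀ a b : Fin 2, a + b + b = a := by decide

omit [Fintype ι] in
theorem involutive_xorInto (t : ι) (f : Bits ι → Fin 2)
    (hf : ∀ x v, f (Function.update x t v) = f x) :
    Function.Involutive fun x : Bits ι => Function.update x t (x t + f x) := by
  intro x
  simp [hf, fin_two_add_add_self]

/-- The basis permutation `x_t ↦ x_t ⊕ f(x)`, where `f` does not depend on `x_t`. -/
def xorInto (t : ι) (f : Bits ι → Fin 2) (hf : ∀ x v, f (Function.update x t v) = f x) :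
    Equiv.Perm (Bits ι) :=
  (involutive_xorInto t f hf).toPerm

omit [Fintype ι] in
theorem xorInto_apply (t : ι) (f : Bits ι → Fin 2) (hf) (x : Bits ι) :
    xorInto t f hf x = Function.update x t (x t + f x) := rfl

omit [Fintype ι] in
theorem xorInto_symm (t : ι) (f : Bits ι → Fin 2) (hf) :
    (xorInto t f hf).symm = xorInto t f hf := rfl

end Classical

/-! ### The Toffoli gate from single-qubit gates and CNOTs. -/

section Toffoli

/-- The primitive eighth root of unity `exp(iπ/4)`. -/
noncomputable def omega8 : ℂ := Complex.exp ((Real.pi / 4 : ℝ) * Complex.I)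

theorem omega8_pow : omega8 ^ 4 = -1 := by
  rw [omega8, ← Complex.exp_nat_mul, ← Complex.exp_pi_mul_I]
  congr 1
  push_cast
  ring

theorem star_omega8_mul : (starRingEnd ℂ) omega8 * omega8 = 1 := by
  rw [mul_comm, Complex.mul_conj, Complex.normSq_eq_norm_sq, omega8,
    Complex.norm_exp_ofReal_mul_I]
  norm_num

/-- The diagonal unitary with entries `1` and `w`. -/
def phaseU (w : ℂ) (hw : (starRingEnd ℂ) w * w = 1) : Matrix.unitaryGroup (Fin 2) ℂ :=
  ⟨!![1, 0; 0, w], by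
    rw [Matrix.mem_unitaryGroup_iff']
    ext i j
    fin_cases i <;> fin_cases j <;>
      simp [Matrix.mul_apply, Fin.sum_univ_two, Matrix.star_apply, hw]⟩

/-- The `NOT` matrix. -/
def pauliX : Matrix.unitaryGroup (Fin 2) ℂ :=
  ⟨!![0, 1; 1, 0], by
    rw [Matrix.mem_unitaryGroup_iff']
    ext i j
    fin_cases i <;> fin_cases j <;> simp [Matrix.mul_apply, Fin.sum_univ_two, Matrix.star_apply]⟩

theorem ofReal_sqrt_two_inv_mul_self : ((√2 : ℝ) : ℂ)⁻¹ * ((√2 : ℝ) : ℂ)⁻¹ = 1 / 2 := by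
  rw [← mul_inv, ← Complex.ofReal_mul, Real.mul_self_sqrt (by norm_num)]
  norm_num

/-- The Hadamard matrix. -/
noncomputable def hadamard : Matrix.unitaryGroup (Fin 2) ℂ :=
  ⟨!![((√2 : ℝ) : ℂ)⁻¹, ((√2 : ℝ) : ℂ)⁻¹; ((√2 : ℝ) : ℂ)⁻¹, -((√2 : ℝ) : ℂ)⁻¹], by
    rw [Matrix.mem_unitaryGroup_iff']
    ext i j
    fin_cases i <;> fin_cases j <;>
      simp [Matrix.mul_apply, Fin.sum_univ_two, Matrix.star_apply] <;>
      rw [← mul_inv, ← Complex.ofReal_mul, Real.mul_self_sqrt (by norm_num)] <;> norm_num⟩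

variable {ι : Type} [Fintype ι] [DecidableEq ι]

theorem phase_op_mulVec (w : ℂ) (hw) (q : ι) (ψ : QState ι) (y : Bits ι) :
    ((QGate.single (phaseU w hw) q).op *ᵥ ψ) y = (if y q = 1 then w else 1) * ψ y := by
  rw [QGate.single_op_mulVec, Fin.sum_univ_two]
  have h : ∀ v : Fin 2, v = 0 ∨ v = 1 := by decide
  rcases h (y q) with h | h
  · rw [← h, Function.update_eq_self, h]
    simp [phaseU]
  · rw [← h, Function.update_eq_self, h]
    simp [phaseU]

theorem pauliX_op_mulVec (q : ι) (ψ : QState ι) (y : Bits ι) :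
    ((QGate.single pauliX q).op *ᵥ ψ) y = ψ (Function.update y q (y q + 1)) := by
  rw [QGate.single_op_mulVec, Fin.sum_univ_two]
  have h : ∀ v : Fin 2, v = 0 ∨ v = 1 := by decide
  rcases h (y q) with h | h <;> rw [h] <;> simp [pauliX]

/-- The gates of the doubly controlled phase flip. -/
noncomputable def cczGates {a b t : ι} (hab : a ≠ b) (hat : a ≠ t) (hbt : b ≠ t) :
    List (QGate ι) :=
  let T := phaseU omega8 star_omega8_mul
  let T' := phaseU ((starRingEnd ℂ) omega8) (by rw [Complex.conj_conj, mul_comm, star_omega8_mul])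
  [.single T a, .single T b, .single T t, .cnot a b hab, .single T' b, .cnot b t hbt, .single T t,
    .cnot a b hab, .cnot b t hbt, .single T' t, .cnot a t hat, .cnot b t hbt, .single T' t,
    .cnot b t hbt]

/-- Over the integers, a + b + t − (a⊕b) − (a⊕t) − (b⊕t) + (a⊕b⊕t) = 4abt. The CNOTs produce the
parities, each phase gate contributes one summand to the exponent of `omega8`, and `omega8 ^ 4 =
-1`. -/
theorem cczGates_op {a b t : ι} (hab : a ≠ b) (hat : a ≠ t) (hbt : b ≠ t) (ψ : QState ι)
    (y : Bits ι) :
    (gatesOp (cczGates hab hat hbt) *ᵥ ψ) y =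
      (if y a = 1 ∧ y b = 1 ∧ y t = 1 then -1 else 1) * ψ y := by
  have hm : ∀ z, (starRingEnd ℂ) omega8 * (omega8 * z) = z := fun z => by
    rw [← mul_assoc, star_omega8_mul, one_mul]
  have h4 : ∀ z, omega8 * (omega8 * (omega8 * (omega8 * z))) = -z := fun z => by
    rw [← neg_one_mul, ← omega8_pow]; ring
  have hfin : ∀ v : Fin 2, v = 0 ∨ v = 1 := by decide
  have hbs := Function.update_eq_self b y
  have hts := Function.update_eq_self t y
  have h11 : (1 + 1 : Fin 2) = 0 := rfl
  simp only [cczGates, gatesOp_cons, gatesOp_nil, Matrix.one_mul, ← Matrix.mulVec_mulVec,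
    phase_op_mulVec, QGate.cnot_op_mulVec, Function.update_self,
    Function.update_of_ne hab, Function.update_of_ne hat,
    Function.update_of_ne hbt, Function.update_of_ne hbt.symm,
    Function.update_idem, Function.update_comm hbt]
  rcases hfin (y a) with ha | ha <;> rcases hfin (y b) with hb | hb <;>
    rcases hfin (y t) with ht | ht <;>
    rw [hb] at hbs <;> rw [ht] at hts <;>
    simp [ha, hb, ht, h11, hbs, hts, hm, h4]

theorem hadamard_op_mulVec (q : ι) (ψ : QState ι) (y : Bits ι) :
    ((QGate.single hadamard q).op *ᵥ ψ) y =
      ((√2 : ℝ) : ℂ)⁻¹ * ψ (Function.update y q 0) +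
        (if y q = 1 then -((√2 : ℝ) : ℂ)⁻¹ else ((√2 : ℝ) : ℂ)⁻¹) * ψ (Function.update y q 1) := by
  rw [QGate.single_op_mulVec, Fin.sum_univ_two]
  have h : ∀ v : Fin 2, v = 0 ∨ v = 1 := by decide
  rcases h (y q) with h | h <;> simp [h, hadamard]

/-- Hadamard gates on the target turn the conditional sign flip into a conditional NOT. With the 14
gates of `cczGates` this makes 16. -/
theorem toffoliGates_op {a b t : ι} (hab : a ≠ b) (hat : a ≠ t) (hbt : b ≠ t) (hf) :
    gatesOp (.single hadamard t :: (cczGates hab hat hbt ++ [.single hadamard t])) =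
      permOp (xorInto t (fun x => x a * x b) hf) := by
  apply QOp.ext_mulVec
  intro ψ y
  rw [permOp_mulVec, xorInto_symm, xorInto_apply]
  have hs := ofReal_sqrt_two_inv_mul_self
  have hfin : ∀ v : Fin 2, v = 0 ∨ v = 1 := by decide
  have hts := Function.update_eq_self t y
  simp only [gatesOp_cons, gatesOp_append, gatesOp_nil, Matrix.one_mul, ← Matrix.mulVec_mulVec]
  rw [hadamard_op_mulVec, cczGates_op, cczGates_op, hadamard_op_mulVec, hadamard_op_mulVec]
  simp only [Function.update_self, Function.update_of_ne hat, Function.update_of_ne hbt,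
    Function.update_idem]
  rcases hfin (y a) with ha | ha <;> rcases hfin (y b) with hb | hb <;>
    rcases hfin (y t) with ht | ht <;>
    rw [ht] at hts <;> simp [ha, hb, ht, hts] <;> 
    first
    | linear_combination 2 * ψ y * hs
    | linear_combination 2 * ψ (Function.update y t 0) * hs
    | linear_combination 2 * ψ (Function.update y t 1) * hs

theorem Realizes.ofGates {S : Set ι} (l : List (QGate ι)) (hl : ∀ g ∈ l, g.support ⊆ S) :
    Realizes S l.length l.length (gatesOp l) := by
  induction l with
  | nil => exact Realizes.one
  | cons g l ih =>
    rw [gatesOp_cons, List.length_cons, add_comm]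
    exact (Realizes.gate g (hl g (by simp))).seq (ih fun g hg => hl g (by simp [hg]))

theorem realizes_toffoli {S : Set ι} {a b t : ι} (hab : a ≠ b) (hat : a ≠ t) (hbt : b ≠ t)
    (hf) (ha : a ∈ S) (hb : b ∈ S) (ht : t ∈ S) :
    Realizes S 16 16 (permOp (xorInto t (fun x => x a * x b) hf)) := by
  rw [← toffoliGates_op hab hat hbt]
  refine Realizes.ofGates (.single hadamard t :: (cczGates hab hat hbt ++ [.single hadamard t])) ?_
  simp [cczGates, QGate.support, Set.insert_subset_iff, ha, hb, ht]

theorem realizes_cnot {S : Set ι} {c t : ι} (hct : c ≠ t) (hf) (hc : c ∈ S) (ht : t ∈ S) :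
    Realizes S 1 1 (permOp (xorInto t (fun x => x c) hf)) := by
  convert Realizes.gate (.cnot c t hct) _ using 1
  · apply QOp.ext_mulVec
    intro ψ y
    rw [permOp_mulVec, QGate.cnot_op_mulVec]
    rfl
  · simp [QGate.support, Set.insert_subset_iff, hc, ht]

theorem realizes_not {S : Set ι} {t : ι} (hf) (ht : t ∈ S) :
    Realizes S 1 1 (permOp (xorInto t (fun _ => 1) hf)) := by
  convert Realizes.gate (.single pauliX t) _ using 1
  · apply QOp.ext_mulVec
    intro ψ y
    rw [permOp_mulVec, pauliX_op_mulVec]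
    rfl
  · simpa [QGate.support] using ht

end Toffoli

/-! ### Permutations with cheap circuits, and a first controlled NOT with a dirty bit. -/

section Synthesis

variable {ι : Type} [Fintype ι] [DecidableEq ι]

/-- The permutation `e` and its inverse are computed by circuits of depth at most `d` and size at
most `s` inside `S`, and `e` neither reads nor writes outside `S`. -/
def Synth (S : Finset ι) (d s : ℕ) (e : Equiv.Perm (Bits ι)) : Prop :=
  Realizes (S : Set ι) d s (permOp e) ∧ Realizes (S : Set ι) d s (permOp e⁻¹) ∧
    ∀ i ∉ S, ∀ x v, e (Function.update x i v) = Function.update (e x) i v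

namespace Synth

variable {S S' : Finset ι} {d d' s s' : ℕ} {e e' : Equiv.Perm (Bits ι)}

theorem mono (h : Synth S d s e) (hS : S ⊆ S') (hd : d ≤ d') (hs : s ≤ s') : Synth S' d' s' e :=
  ⟨h.1.mono (Finset.coe_subset.2 hS) hd hs, h.2.1.mono (Finset.coe_subset.2 hS) hd hs,
    fun i hi => h.2.2 i fun hi' => hi (hS hi')⟩

theorem one : Synth S 0 0 (1 : Equiv.Perm (Bits ι)) :=
  ⟨by rw [permOp_one]; exact Realizes.one, by rw [inv_one, permOp_one]; exact Realizes.one,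
    fun i _ x v => rfl⟩

theorem mul (h : Synth S d s e) (h' : Synth S d' s' e') : Synth S (d + d') (s + s') (e' * e) := by
  refine ⟨?_, ?_, fun i hi x v => ?_⟩
  · rw [permOp_mul]
    exact h.1.seq h'.1
  · rw [mul_inv_rev, permOp_mul]
    exact (h'.2.1.seq h.2.1).mono subset_rfl (by omega) (by omega)
  · rw [Equiv.Perm.mul_apply, Equiv.Perm.mul_apply, h.2.2 i hi, h'.2.2 i hi]

theorem par (h : Synth S d s e) (h' : Synth S' d s' e') (hS : Disjoint S S') :
    Synth (S ∪ S') d (s + s') (e' * e) := by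
  have hS' := Finset.disjoint_coe.2 hS
  refine ⟨?_, ?_, fun i hi x v => ?_⟩
  · rw [permOp_mul, Finset.coe_union]
    exact h.1.par h'.1 hS'
  · rw [mul_inv_rev, permOp_mul, Finset.coe_union, Set.union_comm, add_comm]
    exact h'.2.1.par h.2.1 hS'.symm
  · rw [Finset.notMem_union] at hi
    rw [Equiv.Perm.mul_apply, Equiv.Perm.mul_apply, h.2.2 i hi.1, h'.2.2 i hi.2]

omit [Fintype ι] in
theorem _root_.apply_eq_of_local {i : ι} {e : Equiv.Perm (Bits ι)}
    (h : ∀ x v, e (Function.update x i v) = Function.update (e x) i v) (x : Bits ι) :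
    e x i = x i := by
  have := congrFun (h x (x i)) i
  simpa using this

theorem apply_eq (h : Synth S d s e) {i : ι} (hi : i ∉ S) (x : Bits ι) : e x i = x i :=
  apply_eq_of_local (h.2.2 i hi) x

/-- Such a map is its own inverse, so one circuit serves both directions. -/
theorem xorInto {t : ι} {f : Bits ι → Fin 2} {hf}
    (h : Realizes (S : Set ι) d s (permOp (xorInto t f hf))) (ht : t ∈ S)
    (hS : ∀ i ∉ S, ∀ x v, f (Function.update x i v) = f x) :
    Synth S d s (xorInto t f hf) := by
  refine ⟨h, h, fun i hi x v => ?_⟩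
  have hit : t ≠ i := fun hit => hi (hit ▸ ht)
  rw [xorInto_apply, xorInto_apply, hS i hi, Function.update_of_ne hit, Function.update_comm hit]

end Synth

/-- The basic move: a NOT and a Toffoli. If p is 1, it becomes the conjunction of q and r; if all
three are 1, they stay so. -/
theorem exists_synth_merge {S : Finset ι} {p q r : ι} (hpq : p ≠ q) (hpr : p ≠ r) (hqr : q ≠ r)
    (hp : p ∈ S) (hq : q ∈ S) (hr : r ∈ S) :
    ∃ e : Equiv.Perm (Bits ι), Synth S 17 17 e ∧
      ∀ x, e x = Function.update x p (x p + 1 + x q * x r) := by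
  have hf : ∀ x : Bits ι, ∀ v, Function.update x p v q * Function.update x p v r = x q * x r :=
    fun x v => by rw [Function.update_of_ne hpq.symm, Function.update_of_ne hpr.symm]
  have hT : Synth S 16 16 (xorInto p (fun x => x q * x r) hf) :=
    Synth.xorInto (realizes_toffoli hqr hpq.symm hpr.symm hf hq hr hp) hp fun i hi x v => by
      rw [Function.update_of_ne (ne_of_mem_of_not_mem hq hi),
        Function.update_of_ne (ne_of_mem_of_not_mem hr hi)]
  have hX : Synth S 1 1 (xorInto p (fun _ => 1) fun _ _ => rfl) :=
    Synth.xorInto (realizes_not _ hp) hp fun i hi x v => rfl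
  refine ⟨_, hX.mul hT, fun x => ?_⟩
  rw [Equiv.Perm.mul_apply, xorInto_apply, xorInto_apply, Function.update_self,
    Function.update_idem, Function.update_of_ne hpq.symm, Function.update_of_ne hpr.symm]

omit [Fintype ι] in
theorem prod_update_of_notMem {Q : Finset ι} {t : ι} (ht : t ∉ Q) (x : Bits ι) (v : Fin 2) :
    ∏ q ∈ Q, Function.update x t v q = ∏ q ∈ Q, x q :=
  Finset.prod_congr rfl fun _ hq => Function.update_of_ne (ne_of_mem_of_not_mem hq ht) _ _

/-- A multiply controlled `NOT` with one dirty ancillary qubit, with no attention paid to its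
cost. -/
theorem realizes_controlled_not (Q : Finset ι) {S : Set ι} {t d : ι} (htd : t ≠ d) (ht : t ∉ Q)
    (hd : d ∉ Q) (hQS : ∀ q ∈ Q, q ∈ S) (htS : t ∈ S) (hdS : d ∈ S) :
    Realizes S (33 * 2 ^ Q.card) (33 * 2 ^ Q.card)
      (permOp (xorInto t (fun x => ∏ q ∈ Q, x q) (prod_update_of_notMem ht))) := by
  -- The cost obeys T(m + 1) = 2 T(m) + 32 with T(0) = 1, and this is its exact solution.
  suffices H : Realizes S (33 * 2 ^ Q.card - 32) (33 * 2 ^ Q.card - 32)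
      (permOp (xorInto t (fun x => ∏ q ∈ Q, x q) (prod_update_of_notMem ht))) from
    H.mono subset_rfl (Nat.sub_le _ _) (Nat.sub_le _ _)
  induction Q using Finset.induction_on generalizing t d with
  | empty => exact realizes_not _ htS
  | insert c Q hc ih =>
    rw [Finset.mem_insert, not_or] at ht hd
    have hf : ∀ x : Bits ι, ∀ v, Function.update x t v d * Function.update x t v c = x d * x c :=
      fun x v => by
        rw [Function.update_of_ne htd.symm, Function.update_of_ne (Ne.symm ht.1)]
    have hT : Realizes S 16 16 (permOp (xorInto t (fun x => x d * x c) hf)) :=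
      realizes_toffoli hd.1 htd.symm (Ne.symm ht.1) hf hdS (hQS c (by simp)) htS
    -- Target and dirty bit exchange roles in the recursive call.
    have hD := ih htd.symm hd.2 ht.2 (fun q hq => hQS q (by simp [hq])) hdS htS
    have hpos : 1 ≤ 2 ^ Q.card := Nat.one_le_two_pow
    have heq : xorInto t (fun x => ∏ q ∈ insert c Q, x q)
        (prod_update_of_notMem (by simp [ht])) =
        xorInto d (fun x => ∏ q ∈ Q, x q) (prod_update_of_notMem hd.2) *
          (xorInto t (fun x => x d * x c) hf *
            (xorInto d (fun x => ∏ q ∈ Q, x q) (prod_update_of_notMem hd.2) *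
              xorInto t (fun x => x d * x c) hf)) := by
      -- The unknown value b of the dirty bit enters twice and cancels modulo 2.
      have key : ∀ a b u v : Fin 2, a + u * v = a + b * u + (b + v) * u := by decide
      ext1 x
      simp only [Equiv.Perm.mul_apply, xorInto_apply, prod_update_of_notMem ht.2,
        prod_update_of_notMem hd.2, Finset.prod_insert hc, Function.update_self,
        Function.update_of_ne htd, Function.update_of_ne htd.symm,
        Function.update_of_ne (Ne.symm ht.1), Function.update_of_ne (Ne.symm hd.1)]
      rw [key _ (x d), Function.update_comm htd.symm, Function.update_idem, Function.update_idem,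
        fin_two_add_add_self, Function.update_comm htd, Function.update_eq_self]
    rw [heq, permOp_mul, permOp_mul, permOp_mul]
    refine (((hT.seq hD).seq hT).seq hD).mono subset_rfl ?_ ?_ <;>
    · rw [Finset.card_insert_of_notMem hc, pow_succ]
      omega

end Synthesis

/-! ### Reducing a conjunction with conditionally clean bits. -/

section Reduction

variable {ι : Type} [Fintype ι] [DecidableEq ι]

/-- `e` maps every label that is constantly `1` on `S` to such a label. -/
def PreservesOnes (S : Finset ι) (e : Equiv.Perm (Bits ι)) : Prop :=
  ∀ x, (∀ i ∈ S, x i = 1) → ∀ i ∈ S, e x i = 1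

omit [Fintype ι] in
theorem PreservesOnes.mul {S S' : Finset ι} {e e' : Equiv.Perm (Bits ι)} (h : PreservesOnes S e)
    (h' : PreservesOnes S' e') (hS' : S' ⊆ S) (hloc : ∀ i ∉ S', ∀ x, e' x i = x i) :
    PreservesOnes S (e' * e) := by
  intro x hx i hi
  rw [Equiv.Perm.mul_apply]
  by_cases hi' : i ∈ S'
  · exact h' _ (fun j hj => h x hx j (hS' hj)) i hi'
  · rw [hloc i hi']
    exact h x hx i hi

/-- A cheap permutation of the block `insert z R` that reduces the question whether the block is
constantly `1` to at most `k` of its bits, provided that the bit `z` is `1`. -/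
def Reduction (z : ι) (R : Finset ι) (k d s : ℕ) : Prop :=
  ∃ (e : Equiv.Perm (Bits ι)) (Q : Finset ι), Q ⊆ insert z R ∧ Q.card ≤ k ∧
    Synth (insert z R) d s e ∧ PreservesOnes (insert z R) e ∧
    ∀ x, x z = 1 → (∀ q ∈ Q, e x q = 1) → ∀ i ∈ R, x i = 1

theorem Reduction.mono {z : ι} {R : Finset ι} {k d s k' d' s' : ℕ} (h : Reduction z R k d s)
    (hk : k ≤ k') (hd : d ≤ d') (hs : s ≤ s') : Reduction z R k' d' s' := by
  obtain ⟨e, Q, h1, h2, h3, h4⟩ := h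
  exact ⟨e, Q, h1, h2.trans hk, h3.mono subset_rfl hd hs, h4⟩

theorem Reduction.of_card_le {z : ι} {R : Finset ι} {k : ℕ} (h : R.card ≤ k) :
    Reduction z R k 0 0 :=
  ⟨1, R, Finset.subset_insert z R, h, Synth.one, fun _ hx => hx, fun _ _ hx => hx⟩

theorem fin_two_mul_eq_one : ∀ a b : Fin 2, a * b = 1 → a = 1 ∧ b = 1 := by decide

theorem fin_two_one_add_one_add : ∀ a : Fin 2, 1 + 1 + a = a := by decide

/-- The bits of `B` are merged into a single one with the help of the bits of `E`, if these are
`1`. -/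
theorem exists_gather (n : ℕ) (B E : Finset ι) (hdis : Disjoint B E) (hn : B.card ≤ n)
    (hBE : B.card ≤ E.card + 1) :
    ∃ (e : Equiv.Perm (Bits ι)) (Q : Finset ι), Q ⊆ B ∪ E ∧ Q.card ≤ 1 ∧
      Synth (B ∪ E) (17 * n) (17 * n) e ∧ PreservesOnes (B ∪ E) e ∧
      ∀ x, (∀ i ∈ E, x i = 1) → (∀ q ∈ Q, e x q = 1) → ∀ i ∈ B, x i = 1 := by
  induction n generalizing B E with
  | zero =>
    exact ⟨1, B, Finset.subset_union_left, by omega, Synth.one, fun _ hx => hx, fun _ _ hx => hx⟩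
  | succ n ih =>
    by_cases hB : B.card ≤ 1
    · exact ⟨1, B, Finset.subset_union_left, hB, Synth.one.mono subset_rfl (by omega) (by omega),
        fun _ hx => hx, fun _ _ hx => hx⟩
    obtain ⟨b, hb, b', hb', hbb⟩ := Finset.one_lt_card.1 (not_le.1 hB)
    obtain ⟨p, hp⟩ : E.Nonempty := Finset.card_pos.1 (by omega)
    have hpB : p ∉ B := fun h => Finset.disjoint_left.1 hdis h hp
    have hpb : p ≠ b := fun h => hpB (h ▸ hb)
    have hpb' : p ≠ b' := fun h => hpB (h ▸ hb')
    have hsub : insert p ((B.erase b).erase b') ∪ E.erase p ⊆ B ∪ E := by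
      intro i hi
      simp only [Finset.mem_union, Finset.mem_insert, Finset.mem_erase] at hi ⊢
      rcases hi with (rfl | hi) | hi
      exacts [Or.inr hp, Or.inl hi.2.2, Or.inr hi.2]
    have hcard : (insert p ((B.erase b).erase b')).card + 1 = B.card := by
      rw [Finset.card_insert_of_notMem (by simp [hpB]),
        Finset.card_erase_of_mem (by simp [hb', hbb.symm]), Finset.card_erase_of_mem hb]
      omega
    have hcardE : (E.erase p).card + 1 = E.card := Finset.card_erase_add_one hp
    -- The helper p now carries the conjunction of b and b', so it moves from E to B. Both sets lose
    -- one element, which keeps the inequality between their cardinalities.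
    obtain ⟨e, Q, hQ, hQ1, hs, hones, hsem⟩ := ih (insert p ((B.erase b).erase b')) (E.erase p)
      (by
        rw [Finset.disjoint_left]
        intro i hi hi'
        simp only [Finset.mem_insert, Finset.mem_erase] at hi hi'
        rcases hi with rfl | hi
        · exact hi'.1 rfl
        · exact Finset.disjoint_left.1 hdis hi.2.2 hi'.2) (by omega) (by omega)
    have hpS : p ∈ B ∪ E := Finset.mem_union_right _ hp
    have hbS : b ∈ B ∪ E := Finset.mem_union_left _ hb
    have hbS' : b' ∈ B ∪ E := Finset.mem_union_left _ hb'
    obtain ⟨g, hg, hgx⟩ := exists_synth_merge hpb hpb' hbb hpS hbS hbS'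
    refine ⟨e * g, Q, hQ.trans hsub, hQ1, (hg.mul (hs.mono hsub le_rfl le_rfl)).mono subset_rfl
      (by omega) (by omega), PreservesOnes.mul ?_ hones hsub fun i hi => hs.apply_eq hi, ?_⟩
    · intro x hx i hi
      rw [hgx]
      by_cases hip : i = p
      · subst hip
        rw [Function.update_self, hx _ hpS, hx _ hbS, hx _ hbS']
        rfl
      · rw [Function.update_of_ne hip, hx i hi]
    · intro x hE hx
      have h1 := hsem (g x) (fun i hi => by
        rw [hgx, Function.update_of_ne (Finset.ne_of_mem_erase hi)]
        exact hE i (Finset.mem_of_mem_erase hi)) hx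
      have h2 := h1 p (by simp)
      rw [hgx, Function.update_self, hE p hp, fin_two_one_add_one_add] at h2
      obtain ⟨h2, h3⟩ := fin_two_mul_eq_one _ _ h2
      intro i hi
      by_cases hib : i = b
      · rwa [hib]
      by_cases hib' : i = b'
      · rwa [hib']
      have h4 := h1 i (by simp [hi, hib, hib'])
      rwa [hgx, Function.update_of_ne (ne_of_mem_of_not_mem hi hpB)] at h4

/-- A further set of bits is reduced with the help of a bit that a reduction leaves free. -/
theorem Reduction.extend {z : ι} {R R' : Finset ι} {k k' d d' s s' : ℕ}
    (h : Reduction z R k d s) (hk : k ≤ R.card) (hzR : z ∉ R) (hzR' : z ∉ R')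
    (hdis : Disjoint R R') (h' : ∀ c ∉ R', Reduction c R' k' d' s') :
    Reduction z (R ∪ R') (k + k') (d + d') (s + s') := by
  obtain ⟨e, Q, hQ, hQk, hs, hones, hsem⟩ := h
  have hblock : ∀ i ∈ insert z R, i ∉ R' := by
    intro i hi
    rcases Finset.mem_insert.1 hi with rfl | hi
    exacts [hzR', Finset.disjoint_left.1 hdis hi]
  -- The block has one bit more than R, so some bit is unread; it plays the role of z for R'.
  obtain ⟨c, hcR, hcQ⟩ : ∃ c ∈ insert z R, c ∉ Q := by
    apply Finset.exists_mem_notMem_of_card_lt_card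
    rw [Finset.card_insert_of_notMem hzR]
    omega
  obtain ⟨e', Q', hQ', hQk', hs', hones', hsem'⟩ := h' c (hblock c hcR)
  have hsub : insert z R ⊆ insert z (R ∪ R') :=
    Finset.insert_subset_insert z Finset.subset_union_left
  have hsub' : insert c R' ⊆ insert z (R ∪ R') :=
    Finset.insert_subset (hsub hcR) (Finset.subset_union_right.trans (Finset.subset_insert _ _))
  refine ⟨e' * e, Q ∪ Q', Finset.union_subset (hQ.trans hsub) (hQ'.trans hsub'),
    (Finset.card_union_le _ _).trans (Nat.add_le_add hQk hQk'),
    (hs.mono hsub le_rfl le_rfl).mul (hs'.mono hsub' le_rfl le_rfl),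
    PreservesOnes.mul ?_ hones' hsub' fun i hi => hs'.apply_eq hi, ?_⟩
  · have := PreservesOnes.mul (S := insert z (R ∪ R')) (e := 1) (fun _ hx => hx) hones hsub
      fun i hi => hs.apply_eq hi
    simpa using this
  · intro x hz hx
    have h1 : ∀ i ∈ R, x i = 1 := hsem x hz fun q hq => by
      have h2 := hx q (Finset.mem_union_left _ hq)
      rwa [Equiv.Perm.mul_apply, hs'.apply_eq] at h2
      rw [Finset.mem_insert, not_or]
      exact ⟨fun h => hcQ (h ▸ hq), hblock q (hQ hq)⟩
    -- Only after the first reduction has certified R is c known to be 1.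
    have h3 : e x c = 1 := hones x (by simpa [hz] using h1) c hcR
    have h4 := hsem' (e x) h3 fun q hq => hx q (Finset.mem_union_right _ hq)
    intro i hi
    rcases Finset.mem_union.1 hi with hi | hi
    · exact h1 i hi
    · have h5 := h4 i hi
      rwa [hs.apply_eq fun h => hblock i h hi] at h5

/-- Two further sets of bits are reduced in parallel with the help of two bits that a reduction
leaves free, and the results are merged with the help of the other free bits. -/
theorem Reduction.compose {z : ι} {R R' : Finset ι} {k m r d d' s w : ℕ}
    (h : Reduction z R k d s) (hr : 1 ≤ r) (hk : k + 2 * r ≤ R.card) (hzR : z ∉ R) (hzR' : z ∉ R')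
    (hdis : Disjoint R R') (hm : R'.card ≤ 2 * m)
    (h' : ∀ c, ∀ T : Finset ι, c ∉ T → T.card ≤ m → Reduction c T r d' (w * T.card)) :
    Reduction z (R ∪ R') (k + 1) (d + d' + 34 * r) (s + w * R'.card + 34 * r) := by
  obtain ⟨e, Q, hQ, hQk, hs, hones, hsem⟩ := h
  have hblock : ∀ i ∈ insert z R, i ∉ R' := by
    intro i hi
    rcases Finset.mem_insert.1 hi with rfl | hi
    exacts [hzR', Finset.disjoint_left.1 hdis hi]
  -- Two unread bits seed the two halves; the other 2r − 1 are exactly enough helpers to gather 2r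
  -- bits into one.
  have hfree : 2 * r + 1 ≤ (insert z R \ Q).card := by
    rw [Finset.card_sdiff_of_subset hQ, Finset.card_insert_of_notMem hzR]
    omega
  obtain ⟨a, ha, b, hb, hab⟩ := Finset.one_lt_card.1 (show 1 < (insert z R \ Q).card by omega)
  obtain ⟨haR, haQ⟩ := Finset.mem_sdiff.1 ha
  obtain ⟨hbR, hbQ⟩ := Finset.mem_sdiff.1 hb
  obtain ⟨T, hT, hTm⟩ := Finset.exists_subset_card_eq (s := R') (n := min m R'.card)
    (min_le_right _ _)
  have hTc : (R' \ T).card + T.card = R'.card := Finset.card_sdiff_add_card_eq_card hT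
  obtain ⟨f, P, hP, hPk, hf, hfones, hfsem⟩ := h' a T (fun h => hblock a haR (hT h)) (by omega)
  obtain ⟨f', P', hP', hPk', hf', hfones', hfsem'⟩ := h' b (R' \ T)
    (fun h => hblock b hbR (Finset.sdiff_subset h)) (by omega)
  -- the blocks of the two inner reductions
  have hfdis : Disjoint (insert a T) (insert b (R' \ T)) := by
    rw [Finset.disjoint_left]
    intro i hi hi'
    rcases Finset.mem_insert.1 hi with rfl | hi
    · rcases Finset.mem_insert.1 hi' with rfl | hi'
      exacts [hab rfl, hblock _ haR (Finset.sdiff_subset hi')]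
    · rcases Finset.mem_insert.1 hi' with rfl | hi'
      exacts [hblock _ hbR (hT hi), (Finset.mem_sdiff.1 hi').2 hi]
  -- Running the halves side by side means that d' is paid only once, hence the logarithmic depth.
  have hff := hf.par hf' hfdis
  have hinner : ∀ i ∈ insert z R, i ≠ a → i ≠ b → i ∉ insert a T ∪ insert b (R' \ T) := by
    intro i hi hia hib h
    have := hblock i hi
    simp only [Finset.mem_union, Finset.mem_insert, Finset.mem_sdiff, hia, hib, false_or] at h
    rcases h with h | h
    exacts [this (hT h), this h.1]
  obtain ⟨E, hE⟩ : ∃ E, E = ((insert z R \ Q).erase a).erase b := ⟨_, rfl⟩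
  have hEmem : ∀ i ∈ E, i ∈ insert z R ∧ i ∉ Q ∧ i ≠ a ∧ i ≠ b := by
    intro i hi
    rw [hE, Finset.mem_erase, Finset.mem_erase, Finset.mem_sdiff] at hi
    exact ⟨hi.2.2.1, hi.2.2.2, hi.2.1, hi.1⟩
  have hEc : 2 * r ≤ E.card + 1 := by
    rw [hE, Finset.card_erase_of_mem (Finset.mem_erase.2 ⟨hab.symm, hb⟩),
      Finset.card_erase_of_mem ha]
    omega
  have hPsub : P ∪ P' ⊆ insert a T ∪ insert b (R' \ T) := Finset.union_subset_union hP hP'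
  have hPc : (P ∪ P').card ≤ 2 * r := (Finset.card_union_le _ _).trans (by omega)
  obtain ⟨g, G, hG, hG1, hg, hgones, hgsem⟩ := exists_gather (2 * r) (P ∪ P') E (by
    rw [Finset.disjoint_left]
    intro i hi hiE
    obtain ⟨h1, h2, h3, h4⟩ := hEmem i hiE
    exact hinner i h1 h3 h4 (hPsub hi)) hPc (hPc.trans hEc)
  have hsub : insert z R ⊆ insert z (R ∪ R') :=
    Finset.insert_subset_insert z Finset.subset_union_left
  have hR'sub : R' ⊆ insert z (R ∪ R') :=
    Finset.subset_union_right.trans (Finset.subset_insert _ _)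
  have hfsub : insert a T ⊆ insert z (R ∪ R') :=
    Finset.insert_subset (hsub haR) (hT.trans hR'sub)
  have hfsub' : insert b (R' \ T) ⊆ insert z (R ∪ R') :=
    Finset.insert_subset (hsub hbR) (Finset.sdiff_subset.trans hR'sub)
  have hffsub := Finset.union_subset hfsub hfsub'
  have hgsub : (P ∪ P') ∪ E ⊆ insert z (R ∪ R') :=
    Finset.union_subset (hPsub.trans hffsub) fun i hi => hsub (hEmem i hi).1
  refine ⟨g * ((f' * f) * e), Q ∪ G, Finset.union_subset (hQ.trans hsub) (hG.trans hgsub),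
    (Finset.card_union_le _ _).trans (Nat.add_le_add hQk hG1), ?_, ?_, ?_⟩
  · refine (((hs.mono hsub le_rfl le_rfl).mul (hff.mono hffsub le_rfl le_rfl)).mul
      (hg.mono hgsub le_rfl le_rfl)).mono subset_rfl (by omega) ?_
    rw [← hTc, Nat.mul_add]
    omega
  · refine PreservesOnes.mul ?_ hgones hgsub fun i hi => hg.apply_eq hi
    rw [mul_assoc]
    refine PreservesOnes.mul ?_ hfones' hfsub' fun i hi => hf'.apply_eq hi
    refine PreservesOnes.mul ?_ hfones hfsub fun i hi => hf.apply_eq hi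
    have := PreservesOnes.mul (S := insert z (R ∪ R')) (e := 1) (fun _ hx => hx) hones hsub
      fun i hi => hs.apply_eq hi
    simpa using this
  · intro x hz hx
    simp only [Equiv.Perm.mul_apply] at hx
    have hff_apply : ∀ y i, i ∉ insert a T ∪ insert b (R' \ T) → f' (f y) i = y i :=
      fun y i hi => hff.apply_eq hi y
    have h1 : ∀ i ∈ R, x i = 1 := hsem x hz fun q hq => by
      have h2 := hx q (Finset.mem_union_left _ hq)
      have hq' := hinner q (hQ hq) (fun h => haQ (h ▸ hq)) (fun h => hbQ (h ▸ hq))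
      rwa [hg.apply_eq, hff_apply _ _ hq'] at h2
      rw [Finset.mem_union, not_or]
      exact ⟨fun h => hq' (hPsub h), fun h => (hEmem q h).2.1 hq⟩
    have h3 : ∀ i ∈ insert z R, e x i = 1 := hones x (by simpa [hz] using h1)
    have h4 := hgsem (f' (f (e x))) (fun i hi => by
      obtain ⟨h5, h6, h7, h8⟩ := hEmem i hi
      rw [hff_apply _ _ (hinner i h5 h7 h8)]
      exact h3 i h5) fun q hq => hx q (Finset.mem_union_right _ hq)
    have h5 : ∀ i ∈ T, e x i = 1 := hfsem (e x) (h3 a haR) fun q hq => by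
      have h6 := h4 q (Finset.mem_union_left _ hq)
      rwa [hf'.apply_eq (Finset.disjoint_left.1 hfdis (hP hq))] at h6
    have h6 : ∀ i ∈ R' \ T, f (e x) i = 1 := hfsem' (f (e x)) (by
      rw [hf.apply_eq (Finset.disjoint_right.1 hfdis (Finset.mem_insert_self _ _))]
      exact h3 b hbR) fun q hq => h4 q (Finset.mem_union_right _ hq)
    intro i hi
    rcases Finset.mem_union.1 hi with hi | hi
    · exact h1 i hi
    · rw [← hs.apply_eq (fun h => hblock i h hi) x]
      by_cases hiT : i ∈ T
      · exact h5 i hiT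
      · have hiT' : i ∈ R' \ T := Finset.mem_sdiff.2 ⟨hi, hiT⟩
        rw [← hf.apply_eq (Finset.disjoint_right.1 hfdis (Finset.mem_insert_of_mem hiT')) (e x)]
        exact h6 i hiT'

/-- A bound for the cost of the reduction of small blocks, from one for blocks half the size. -/
theorem Reduction.compose_uniform {c k m r d d' w : ℕ} (hr : 1 ≤ r) (hk : k + 2 * r ≤ c)
    (h : ∀ z, ∀ R : Finset ι, z ∉ R → R.card ≤ c → Reduction z R k d (w * R.card)) {w' : ℕ}
    (hw : w ≤ w') (hc : w * c + 34 * r ≤ w' * c)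
    (h' : ∀ z, ∀ R : Finset ι, z ∉ R → R.card ≤ m → Reduction z R r d' (w' * R.card)) :
    ∀ z, ∀ R : Finset ι, z ∉ R → R.card ≤ c + 2 * m →
      Reduction z R (k + 1) (d + d' + 34 * r) (w' * R.card) := by
  intro z R hz hR
  by_cases hRc : R.card ≤ c
  · exact (h z R hz hRc).mono (by omega) (by omega) (Nat.mul_le_mul_right _ hw)
  obtain ⟨T, hT, hTc⟩ := Finset.exists_subset_card_eq (s := R) (n := c) (by omega)
  have hcard : (R \ T).card + T.card = R.card := Finset.card_sdiff_add_card_eq_card hT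
  have := (h z T (fun h => hz (hT h)) hTc.le).compose (R' := R \ T) hr (by omega)
    (fun h => hz (hT h)) (fun h => hz (Finset.sdiff_subset h)) Finset.disjoint_sdiff (by omega) h'
  rw [Finset.union_sdiff_of_subset hT] at this
  refine this.mono le_rfl le_rfl ?_
  -- By `hc`, the higher rate w' on the c bits of T pays for the gathering cost 34r.
  rw [← hcard, hTc, Nat.mul_add]
  omega

theorem reduction_of_card_le_two (z : ι) (R : Finset ι) (hz : z ∉ R) (hR : R.card ≤ 2) :
    Reduction z R 1 17 (17 * R.card) := by
  by_cases h1 : R.card ≤ 1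
  · exact (Reduction.of_card_le h1).mono le_rfl (by omega) (by omega)
  obtain ⟨a, b, hab, rfl⟩ := Finset.card_eq_two.1 (show R.card = 2 by omega)
  have hz' : z ≠ a ∧ z ≠ b := by simpa using hz
  obtain ⟨e, he, hex⟩ := exists_synth_merge (S := insert z {a, b}) hz'.1 hz'.2 hab
    (by simp) (by simp) (by simp)
  refine ⟨e, {z}, by simp, by simp, he.mono subset_rfl le_rfl (by omega), ?_, ?_⟩
  · intro x hx i hi
    rw [hex]
    by_cases hip : i = z
    · subst hip
      rw [Function.update_self, hx _ (by simp), hx a (by simp), hx b (by simp)]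
      rfl
    · rw [Function.update_of_ne hip, hx i hi]
  · intro x hxz hx
    have h2 := hx z (by simp)
    rw [hex, Function.update_self, hxz, fin_two_one_add_one_add] at h2
    simpa using fin_two_mul_eq_one _ _ h2

/-- Two pairs are treated one after the other: a single reduced pair leaves too few free bits for
`Reduction.compose`, since 1 + 2 > 2. -/
theorem reduction_of_card_le_four (z : ι) (R : Finset ι) (hz : z ∉ R) (hR : R.card ≤ 4) :
    Reduction z R 2 34 (17 * R.card) := by
  by_cases h1 : R.card ≤ 2
  · exact (reduction_of_card_le_two z R hz h1).mono (by omega) (by omega) le_rfl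
  obtain ⟨T, hT, hTc⟩ := Finset.exists_subset_card_eq (s := R) (n := 2) (by omega)
  have hcard : (R \ T).card + T.card = R.card := Finset.card_sdiff_add_card_eq_card hT
  have := (reduction_of_card_le_two z T (fun h => hz (hT h)) hTc.le).extend (R' := R \ T)
    (by omega) (fun h => hz (hT h)) (fun h => hz (Finset.sdiff_subset h)) Finset.disjoint_sdiff
    fun c hc => reduction_of_card_le_two c _ hc (by omega)
  rw [Finset.union_sdiff_of_subset hT] at this
  refine this.mono le_rfl le_rfl ?_
  omega

theorem reduction_of_card_le_eight (z : ι) (R : Finset ι) (hz : z ∉ R) (hR : R.card ≤ 8) :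
    Reduction z R 3 85 (34 * R.card) :=
  Reduction.compose_uniform (c := 4) (m := 2) le_rfl le_rfl reduction_of_card_le_four (w' := 34)
    (by omega) (by omega) (fun z R hz hR => (reduction_of_card_le_two z R hz hR).mono le_rfl le_rfl
      (by omega)) z R hz hR

theorem reduction_of_card_le_sixteen (z : ι) (R : Finset ι) (hz : z ∉ R) (hR : R.card ≤ 16) :
    Reduction z R 4 187 (51 * R.card) :=
  Reduction.compose_uniform (c := 8) (m := 4) (r := 2) (by omega) (by omega)
    reduction_of_card_le_eight (w' := 51) (by omega) (by omega)
    (fun z R hz hR => (reduction_of_card_le_four z R hz hR).mono le_rfl le_rfl (by omega)) z R hz hR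

/-- The recursion reproduces its own bound when r = k + 1, which needs k + 2(k + 1) ≤ c. Among the
preceding blocks, c = 8 with k = 3 fails (11 > 8), while c = 16 with k = 4 works (14 ≤ 16). Each
step adds depth 187 + 34 · 5 = 357, and 51 · 16 + 170 ≤ 68 · 16 keeps the rate at 68. -/
theorem reduction_of_card_le_two_pow (j : ℕ) :
    ∀ (z : ι) (R : Finset ι), z ∉ R → R.card ≤ 2 ^ j →
      Reduction z R 5 (357 * j) (68 * R.card) := by
  induction j with
  | zero =>
    intro z R hz hR
    exact (Reduction.of_card_le (by omega)).mono le_rfl (by omega) (by omega)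
  | succ j ih =>
    intro z R hz hR
    rw [pow_succ] at hR
    exact (Reduction.compose_uniform (c := 16) (m := 2 ^ j) (r := 5) (by omega) (by omega)
      reduction_of_card_le_sixteen (w' := 68) (by omega) (by omega) ih z R hz (by omega)).mono le_rfl
        (by omega) le_rfl

end Reduction

/-! ### The controlled NOT of logarithmic depth and linear size. -/

section Toffoli

variable {ι : Type} [Fintype ι] [DecidableEq ι]

theorem fin_two_eq_iff : ∀ a b : Fin 2, a = b ↔ (a = 1 ↔ b = 1) := by decide

omit [Fintype ι] in
theorem prod_eq_one_iff_fin_two {S : Finset ι} {x : Bits ι} :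
    ∏ i ∈ S, x i = 1 ↔ ∀ i ∈ S, x i = 1 := by
  refine ⟨fun h => ?_, Finset.prod_eq_one⟩
  induction S using Finset.induction_on with
  | empty => simp
  | insert a S ha ih =>
    rw [Finset.prod_insert ha] at h
    obtain ⟨h1, h2⟩ := fin_two_mul_eq_one _ _ h
    simpa [h1] using ih h2

/-- The multiply controlled `NOT` with one dirty ancillary qubit `a`, from a reduction of the block
of its controls. -/
theorem Reduction.realizes_controlled_not {z t a : ι} {R : Finset ι} {k d s : ℕ}
    (h : Reduction z R k d s) (hk : k ≤ R.card) (hz : z ∉ R) (hta : t ≠ a) (ht : t ∉ insert z R)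
    (ha : a ∉ insert z R) :
    Realizes Set.univ (4 * d + 2 * (33 * 2 ^ (k + 1)) + 2) (4 * s + 2 * (33 * 2 ^ (k + 1)) + 2)
      (permOp (xorInto t (fun x => ∏ i ∈ insert z R, x i) (prod_update_of_notMem ht))) := by
  obtain ⟨e, Q, hQ, hQk, hs, hones, hsem⟩ := h
  -- An unread bit of the block is the dirty ancilla of the small controlled NOT, because a is now
  -- one of its controls.
  obtain ⟨c, hcR, hcQ⟩ : ∃ c ∈ insert z R, c ∉ Q := by
    apply Finset.exists_mem_notMem_of_card_lt_card
    rw [Finset.card_insert_of_notMem hz]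
    omega
  have htQ : t ∉ insert a Q := by
    rw [Finset.mem_insert, not_or]
    exact ⟨hta, fun h => ht (hQ h)⟩
  have haz : a ≠ z := fun h => ha (by simp [h])
  have htz : t ≠ z := fun h => ht (by simp [h])
  have hcard : (insert a Q).card ≤ k + 1 := (Finset.card_insert_le _ _).trans (by omega)
  have hT := (_root_.realizes_controlled_not (insert a Q) (S := Set.univ) (t := t) (d := c)
    (ne_of_mem_of_not_mem hcR ht).symm htQ
    (by rw [Finset.mem_insert, not_or]; exact ⟨ne_of_mem_of_not_mem hcR ha, hcQ⟩)
    (fun _ _ => trivial) trivial trivial).mono (d' := 33 * 2 ^ (k + 1)) (s' := 33 * 2 ^ (k + 1))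
      subset_rfl (Nat.mul_le_mul_left _ (Nat.pow_le_pow_right (by omega) hcard))
      (Nat.mul_le_mul_left _ (Nat.pow_le_pow_right (by omega) hcard))
  have hN := realizes_cnot (S := Set.univ) haz.symm
    (fun x v => Function.update_of_ne haz.symm _ _) trivial trivial
  obtain ⟨A, hA⟩ : ∃ A, A = e⁻¹ * (xorInto t (fun x => ∏ q ∈ insert a Q, x q)
    (prod_update_of_notMem htQ) * e) := ⟨_, rfl⟩
  have hAx : ∀ x, A x = Function.update x t (x t + x a * ∏ q ∈ Q, e x q) := by
    intro x
    rw [hA, Equiv.Perm.mul_apply, Equiv.Perm.mul_apply, Equiv.Perm.inv_eq_iff_eq, xorInto_apply,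
      hs.2.2 t ht, Finset.prod_insert fun h => ha (hQ h), hs.apply_eq ht, hs.apply_eq ha]
  have hAr := (((hs.1.mono (Set.subset_univ _) le_rfl le_rfl).seq hT).seq
    (hs.2.1.mono (Set.subset_univ _) le_rfl le_rfl))
  rw [← permOp_mul, ← permOp_mul, ← hA] at hAr
  have htQ' : t ∉ Q := fun h => ht (hQ h)
  have haQ' : a ∉ Q := fun h => ha (hQ h)
  have heq : xorInto t (fun x => ∏ i ∈ insert z R, x i) (prod_update_of_notMem ht) =
      xorInto a (fun x => x z) (fun x v => Function.update_of_ne haz.symm _ _) *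
        (A * (xorInto a (fun x => x z) (fun x v => Function.update_of_ne haz.symm _ _) * A)) := by
    -- Here v is the dirty value of a, w is x_z and p the product over Q. The last CNOT restores a.
    have key : ∀ u v w p : Fin 2, u + v * p + (v + w) * p = u + w * p := by decide
    ext1 x
    have hsem' : ∏ i ∈ insert z R, x i = x z * ∏ q ∈ Q, e x q := by
      rw [fin_two_eq_iff, prod_eq_one_iff_fin_two]
      constructor
      · intro h1
        rw [h1 z (by simp), one_mul, prod_eq_one_iff_fin_two]
        exact fun q hq => hones x h1 q (hQ hq)
      · intro h1
        obtain ⟨h2, h3⟩ := fin_two_mul_eq_one _ _ h1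
        rw [prod_eq_one_iff_fin_two] at h3
        simpa [h2] using hsem x h2 h3
    simp only [Equiv.Perm.mul_apply, xorInto_apply, hAx, hs.2.2 t ht, hs.2.2 a ha,
      prod_update_of_notMem htQ', prod_update_of_notMem haQ', Function.update_self,
      Function.update_of_ne hta, Function.update_of_ne hta.symm,
      Function.update_of_ne htz.symm, Function.update_of_ne haz.symm]
    rw [key, hsem', Function.update_comm hta.symm, Function.update_idem, Function.update_idem,
      fin_two_add_add_self, Function.update_comm hta, Function.update_eq_self]
  rw [heq, permOp_mul, permOp_mul, permOp_mul]
  exact (((hAr.seq hN).seq hAr).seq hN).mono subset_rfl (by omega) (by omega)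

/-- A multiply controlled `NOT` with one dirty ancillary qubit `a`, of logarithmic depth and linear
size. -/
theorem realizes_controlled_not_log_depth {S : Finset ι} {t a : ι} (hta : t ≠ a) (ht : t ∉ S)
    (ha : a ∉ S) :
    Realizes Set.univ (1428 * (Nat.log 2 S.card + 1) + 4226) (272 * S.card + 4226)
      (permOp (xorInto t (fun x => ∏ i ∈ S, x i) (prod_update_of_notMem ht))) := by
  -- Small sets take the exponential construction, at cost at most 33 · 2^6. Otherwise five outputs
  -- fit into the erased set, and 4226 = 2 · 33 · 2^6 + 2.
  by_cases hS : S.card ≤ 6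
  · have h6 : 2 ^ S.card ≤ 2 ^ 6 := Nat.pow_le_pow_right (by omega) hS
    exact (realizes_controlled_not S hta ht ha (fun _ _ => trivial) trivial trivial).mono
      subset_rfl (by omega) (by omega)
  obtain ⟨z, hz⟩ : S.Nonempty := Finset.card_pos.1 (by omega)
  have hcard : (S.erase z).card + 1 = S.card := Finset.card_erase_add_one hz
  have hlog := Nat.lt_pow_succ_log_self (b := 2) (by omega) S.card
  have hred := reduction_of_card_le_two_pow (Nat.log 2 S.card + 1) z (S.erase z) (by simp)
    (by rw [Nat.succ_eq_add_one] at hlog; omega)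
  have := hred.realizes_controlled_not (t := t) (a := a) (by omega) (by simp) hta
    (by rwa [Finset.insert_erase hz]) (by rwa [Finset.insert_erase hz])
  simp only [Finset.insert_erase hz] at this
  exact this.mono subset_rfl (by omega) (by omega)

end Toffoli

/-! ### Algebra of controlled gates. -/

section Controlled

variable {n : ℕ}

theorem controlledGate_mulVec (U : Matrix.unitaryGroup (Fin 2) ℂ) (ψ : QState (Fin (n + 1)))
    (y : Bits (Fin (n + 1))) :
    (controlledGate n U *ᵥ ψ) y =
      if ∀ i : Fin n, y i.castSucc = 1 then ((QGate.single U (Fin.last n)).op *ᵥ ψ) y else ψ y := by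
  have hj : ∀ x : Bits (Fin (n + 1)), (∀ j, j ≠ Fin.last n → y j = x j) ↔
      ∀ i : Fin n, y i.castSucc = x i.castSucc := by
    intro x
    simp [Fin.forall_fin_succ']
  split_ifs with hy
  · simp only [Matrix.mulVec, dotProduct, controlledGate, QGate.op, Matrix.of_apply, hj]
    refine Finset.sum_congr rfl fun x _ => ?_
    congr 1
    by_cases h : ∀ i : Fin n, y i.castSucc = x i.castSucc
    · rw [if_pos h, if_pos fun i => by rw [← h i, hy i]]
    · rw [if_neg h]
      split_ifs with h1 h2
      · rfl
      · exact absurd (fun i => by rw [h2]) h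
      · rfl
  · simp only [Matrix.mulVec, dotProduct, controlledGate, Matrix.of_apply]
    rw [Finset.sum_eq_single y]
    · simp [hy]
    · intro x _ hx
      split_ifs with h1 h2 h2
      · exact absurd (fun i => by rw [h2 i, h1 i]) hy
      · simp
      · exact absurd h2.symm hx
      · simp
    · simp

theorem single_op_mul {ι : Type} [Fintype ι] [DecidableEq ι] (U V : Matrix.unitaryGroup (Fin 2) ℂ)
    (q : ι) : (QGate.single U q).op * (QGate.single V q).op = (QGate.single (U * V) q).op := by
  apply QOp.ext_mulVec
  intro ψ y
  simp only [← Matrix.mulVec_mulVec, QGate.single_op_mulVec, Fin.sum_univ_two,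
    Function.update_self, Function.update_idem, Submonoid.coe_mul, Matrix.mul_apply]
  ring

theorem single_op_one {ι : Type} [Fintype ι] [DecidableEq ι] (q : ι) :
    (QGate.single 1 q).op = (1 : QOp ι) := by
  apply QOp.ext_mulVec
  intro ψ y
  rw [QGate.single_op_mulVec]
  simp [Matrix.one_apply]

theorem controlledGate_mul (U V : Matrix.unitaryGroup (Fin 2) ℂ) :
    controlledGate n (U * V : Matrix.unitaryGroup (Fin 2) ℂ) =
      controlledGate n U * controlledGate n V := by
  apply QOp.ext_mulVec
  intro ψ y
  rw [← Matrix.mulVec_mulVec, controlledGate_mulVec, controlledGate_mulVec]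
  by_cases h : ∀ i : Fin n, y i.castSucc = 1
  · rw [if_pos h, if_pos h, ← single_op_mul, ← Matrix.mulVec_mulVec, QGate.single_op_mulVec,
      QGate.single_op_mulVec]
    refine Finset.sum_congr rfl fun b _ => ?_
    rw [controlledGate_mulVec, if_pos fun i => by
      rw [Function.update_of_ne (Fin.castSucc_lt_last i).ne, h i]]
  · rw [if_neg h, if_neg h, controlledGate_mulVec, if_neg h]

/-- The conjugating gates need no controls: where some control is 0, they cancel. -/
theorem controlledGate_conj (U V : Matrix.unitaryGroup (Fin 2) ℂ) :
    controlledGate n (V * U * V⁻¹ : Matrix.unitaryGroup (Fin 2) ℂ) =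
      (QGate.single V (Fin.last n)).op *
        (controlledGate n U * (QGate.single V⁻¹ (Fin.last n)).op) := by
  apply QOp.ext_mulVec
  intro ψ y
  have hup : ∀ b, (∀ i : Fin n, Function.update y (Fin.last n) b i.castSucc = 1) ↔
      ∀ i : Fin n, y i.castSucc = 1 := fun b => by simp
  rw [controlledGate_mulVec, ← Matrix.mulVec_mulVec, ← Matrix.mulVec_mulVec,
    QGate.single_op_mulVec V]
  simp only [controlledGate_mulVec, hup]
  split_ifs with h
  · rw [← QGate.single_op_mulVec V, ← single_op_mul, ← single_op_mul, Matrix.mulVec_mulVec,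
      Matrix.mulVec_mulVec, Matrix.mul_assoc]
  · rw [← QGate.single_op_mulVec V, Matrix.mulVec_mulVec, single_op_mul, mul_inv_cancel,
      single_op_one, Matrix.one_mulVec]

theorem toffoliGate_mulVec (ψ : QState (Fin (n + 1))) (y : Bits (Fin (n + 1))) :
    (toffoliGate n *ᵥ ψ) y = ψ (Function.update y (Fin.last n)
      (y (Fin.last n) + if ∀ i : Fin n, y i.castSucc = 1 then 1 else 0)) :=
  permOp_mulVec (xorInto (Fin.last n)
    (fun x => if ∀ i : Fin n, x i.castSucc = 1 then 1 else 0) fun x v => by simp) ψ y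

theorem toffoliGate_eq : toffoliGate n = controlledGate n pauliX := by
  apply QOp.ext_mulVec
  intro ψ y
  rw [toffoliGate_mulVec, controlledGate_mulVec, pauliX_op_mulVec]
  split_ifs
  · rfl
  · rw [add_zero, Function.update_eq_self]

end Controlled

/-! ### Implementations with a dirty register. -/

section Implements

/-- `V` is implemented with a dirty ancillary register by a circuit of depth at most `d` and size
at most `s`. -/
def Implementable {ι : Type} (κ : Type) [Fintype ι] [DecidableEq ι] [Fintype κ] [DecidableEq κ]
    (d s : ℕ) (V : QOp ι) : Prop :=
  ∃ C : QCircuit (ι ⊕ κ), ImplementsWithDirty C V ∧ C.depth ≤ d ∧ C.size ≤ s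

variable {ι κ : Type} [Fintype ι] [DecidableEq ι] [Fintype κ] [DecidableEq κ]

theorem implementable_iff {d s : ℕ} {V : QOp ι} :
    Implementable κ d s V ↔ ∃ A, Realizes (Set.univ : Set (ι ⊕ κ)) d s A ∧
      ∀ (ψ : QState ι) (φ : QState κ), A *ᵥ tensorState ψ φ = tensorState (V *ᵥ ψ) φ := by
  constructor
  · rintro ⟨C, h1, h2, h3⟩
    exact ⟨C.op, ⟨C, h2, h3, fun _ _ => Set.subset_univ _, rfl⟩, h1⟩
  · rintro ⟨A, ⟨C, h2, h3, -, rfl⟩, h1⟩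
    exact ⟨C, h1, h2, h3⟩

theorem Implementable.mono {d d' s s' : ℕ} {V : QOp ι} (h : Implementable κ d s V) (hd : d ≤ d')
    (hs : s ≤ s') : Implementable κ d' s' V := by
  obtain ⟨C, h1, h2, h3⟩ := h
  exact ⟨C, h1, h2.trans hd, h3.trans hs⟩

theorem Implementable.mul {d d' s s' : ℕ} {V V' : QOp ι} (h : Implementable κ d s V)
    (h' : Implementable κ d' s' V') : Implementable κ (d + d') (s + s') (V * V') := by
  rw [implementable_iff] at *
  obtain ⟨A, hA, hV⟩ := h
  obtain ⟨A', hA', hV'⟩ := h'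
  refine ⟨A * A', (hA'.seq hA).mono subset_rfl (by omega) (by omega), fun ψ φ => ?_⟩
  rw [← Matrix.mulVec_mulVec, hV', hV, Matrix.mulVec_mulVec]

omit [Fintype ι] [Fintype κ] in
theorem tensorState_update_inl (ψ : QState ι) (φ : QState κ) (z : Bits (ι ⊕ κ)) (q : ι)
    (b : Fin 2) :
    tensorState ψ φ (Function.update z (Sum.inl q) b) =
      ψ (Function.update (fun i => z (Sum.inl i)) q b) * φ (fun k => z (Sum.inr k)) := by
  unfold tensorState
  congr 2
  · funext i
    by_cases h : i = q
    · subst h; simp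
    · rw [Function.update_of_ne h, Function.update_of_ne (by simpa using h)]

theorem implementable_single (U : Matrix.unitaryGroup (Fin 2) ℂ) (q : ι) :
    Implementable κ 1 1 (QGate.single U q).op := by
  rw [implementable_iff]
  refine ⟨_, Realizes.gate (.single U (Sum.inl q)) (Set.subset_univ _), fun ψ φ => ?_⟩
  funext z
  rw [QGate.single_op_mulVec]
  simp only [tensorState_update_inl]
  rw [tensorState, QGate.single_op_mulVec, Finset.sum_mul]
  simp only [mul_assoc]

theorem implementable_toffoliGate (n : ℕ) :
    Implementable (Fin 1) (1428 * (Nat.log 2 n + 1) + 4226) (272 * n + 4226) (toffoliGate n) := by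
  let S : Finset (Fin (n + 1) ⊕ Fin 1) := Finset.univ.image fun i : Fin n => Sum.inl i.castSucc
  have hS : S.card = n := by
    rw [Finset.card_image_of_injective _ fun i j h => by simpa using h, Finset.card_fin]
  have ht : Sum.inl (Fin.last n) ∉ S := by simp [S, (Fin.castSucc_lt_last _).ne]
  have ha : Sum.inr 0 ∉ S := by simp [S]
  have h := realizes_controlled_not_log_depth (by simp) ht ha
  rw [hS] at h
  rw [implementable_iff]
  refine ⟨_, h, fun ψ φ => ?_⟩
  funext z
  have hprod : ∏ i ∈ S, z i = if ∀ i : Fin n, z (Sum.inl i.castSucc) = 1 then 1 else 0 := by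
    rw [fin_two_eq_iff, prod_eq_one_iff_fin_two]
    simp [S]
  rw [permOp_mulVec, xorInto_symm, xorInto_apply, tensorState_update_inl, tensorState,
    toffoliGate_mulVec, hprod]

end Implements

/-! ### Unitary involutions and the final constants. -/

section Involutions

/-- Every unitary involution is a conjugate of `NOT` or a product of two such conjugates. -/
theorem exists_conj_of_sq_eq_one (U : Matrix.unitaryGroup (Fin 2) ℂ) (hU : U ^ 2 = 1) :
    (∃ V, U = V * pauliX * V⁻¹) ∨ ∃ V W, U = (V * pauliX * V⁻¹) * (W * pauliX * W⁻¹) := by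
  have hHX : ((hadamard * pauliX * hadamard⁻¹ : Matrix.unitaryGroup (Fin 2) ℂ) :
      Matrix (Fin 2) (Fin 2) ℂ) = !![1, 0; 0, -1] := by
    have hs := ofReal_sqrt_two_inv_mul_self
    change (hadamard : Matrix (Fin 2) (Fin 2) ℂ) * (pauliX : Matrix (Fin 2) (Fin 2) ℂ) *
      star (hadamard : Matrix (Fin 2) (Fin 2) ℂ) = _
    ext i j
    fin_cases i <;> fin_cases j <;>
      simp [hadamard, pauliX, Matrix.mul_apply, Fin.sum_univ_two, Matrix.star_apply] <;>
      first
      | linear_combination 2 * hs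
      | linear_combination -2 * hs
  have hXHX : ((pauliX * hadamard * pauliX * (pauliX * hadamard)⁻¹ :
      Matrix.unitaryGroup (Fin 2) ℂ) : Matrix (Fin 2) (Fin 2) ℂ) = !![-1, 0; 0, 1] := by
    have : (pauliX * hadamard * pauliX * (pauliX * hadamard)⁻¹ : Matrix.unitaryGroup (Fin 2) ℂ) =
        pauliX * (hadamard * pauliX * hadamard⁻¹) * pauliX⁻¹ := by group
    rw [this, Submonoid.coe_mul, Submonoid.coe_mul, hHX]
    change (pauliX : Matrix (Fin 2) (Fin 2) ℂ) * _ * star (pauliX : Matrix (Fin 2) (Fin 2) ℂ) = _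
    ext i j
    fin_cases i <;> fin_cases j <;>
      simp [pauliX, Matrix.mul_apply, Fin.sum_univ_two, Matrix.star_apply]
  -- The inverse of a unitary is its adjoint, and U is its own inverse.
  have hH : (U : Matrix (Fin 2) (Fin 2) ℂ).IsHermitian := by
    have : U⁻¹ = U := inv_eq_of_mul_eq_one_left (by rw [← sq, hU])
    exact congrArg Subtype.val this
  obtain ⟨D, hD⟩ : ∃ D, D = (hH.eigenvectorUnitary)⁻¹ * U * hH.eigenvectorUnitary := ⟨_, rfl⟩
  have hUD : U = hH.eigenvectorUnitary * D * (hH.eigenvectorUnitary)⁻¹ := by rw [hD]; group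
  have hDc : (D : Matrix (Fin 2) (Fin 2) ℂ) =
      Matrix.diagonal (RCLike.ofReal ∘ hH.eigenvalues) := by
    rw [← hH.conjStarAlgAut_star_eigenvectorUnitary, hD, Unitary.conjStarAlgAut_star_apply]
    rfl
  have hD2 : D * D = 1 := by
    rw [hD]
    calc _ = (hH.eigenvectorUnitary)⁻¹ * U ^ 2 * hH.eigenvectorUnitary := by rw [sq]; group
      _ = 1 := by rw [hU]; group
  have hval : ∀ i, (D : Matrix (Fin 2) (Fin 2) ℂ) i i = 1 ∨
      (D : Matrix (Fin 2) (Fin 2) ℂ) i i = -1 := by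
    intro i
    have h := congrFun (congrFun (congrArg Subtype.val hD2) i) i
    rw [Submonoid.coe_mul, hDc, Matrix.diagonal_mul_diagonal, Matrix.diagonal_apply_eq] at h
    rw [hDc, Matrix.diagonal_apply_eq]
    exact mul_self_eq_one_iff.1 (by simpa using h)
  have hoff : ∀ i j, i ≠ j → (D : Matrix (Fin 2) (Fin 2) ℂ) i j = 0 := by
    intro i j hij
    rw [hDc, Matrix.diagonal_apply_ne _ hij]
  have hform : (D : Matrix (Fin 2) (Fin 2) ℂ) = !![D.1 0 0, 0; 0, D.1 1 1] := by
    ext i j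
    fin_cases i <;> fin_cases j <;> simp [hoff]
  have hDcases : (∃ V, D = V * pauliX * V⁻¹) ∨
      ∃ V W, D = (V * pauliX * V⁻¹) * (W * pauliX * W⁻¹) := by
    -- With Z = diag(1, −1), the cases are I = Z · Z, Z, −Z and −I = Z · (−Z). Conjugates of NOT
    -- have determinant −1, so ±I need two factors.
    rcases hval 0 with h0 | h0 <;> rcases hval 1 with h1 | h1 <;> rw [h0, h1] at hform
    · refine Or.inr ⟨hadamard, hadamard, Subtype.ext ?_⟩
      rw [Submonoid.coe_mul, hHX, hform]
      ext i j
      fin_cases i <;> fin_cases j <;> simp [Matrix.mul_apply]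
    · exact Or.inl ⟨hadamard, Subtype.ext (by rw [hHX, hform])⟩
    · exact Or.inl ⟨pauliX * hadamard, Subtype.ext (by rw [hXHX, hform])⟩
    · refine Or.inr ⟨hadamard, pauliX * hadamard, Subtype.ext ?_⟩
      rw [Submonoid.coe_mul, hHX, hXHX, hform]
      ext i j
      fin_cases i <;> fin_cases j <;> simp [Matrix.mul_apply]
  rcases hDcases with ⟨V, hV⟩ | ⟨V, W, hVW⟩
  · exact Or.inl ⟨hH.eigenvectorUnitary * V, hUD.trans (by rw [hV]; group)⟩
  · exact Or.inr ⟨hH.eigenvectorUnitary * V, hH.eigenvectorUnitary * W, hUD.trans (by rw [hVW]; group)⟩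

theorem implementable_controlledGate_conj (n : ℕ) (V : Matrix.unitaryGroup (Fin 2) ℂ) :
    Implementable (Fin 1) (1428 * (Nat.log 2 n + 1) + 4228) (272 * n + 4228)
      (controlledGate n (V * pauliX * V⁻¹ : Matrix.unitaryGroup (Fin 2) ℂ)) := by
  rw [controlledGate_conj, ← toffoliGate_eq]
  exact ((implementable_single V (Fin.last n)).mul ((implementable_toffoliGate n).mul
    (implementable_single V⁻¹ (Fin.last n)))).mono (by omega) (by omega)

theorem implementable_controlledGate (n : ℕ) (U : Matrix.unitaryGroup (Fin 2) ℂ)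
    (hU : U ^ 2 = 1) :
    Implementable (Fin 1) (2856 * (Nat.log 2 n + 1) + 8456) (544 * n + 8456)
      (controlledGate n U) := by
  rcases exists_conj_of_sq_eq_one U hU with ⟨V, rfl⟩ | ⟨V, W, rfl⟩
  · exact (implementable_controlledGate_conj n V).mono (by omega) (by omega)
  · rw [controlledGate_mul]
    exact ((implementable_controlledGate_conj n V).mul
      (implementable_controlledGate_conj n W)).mono (by omega) (by omega)

/-- The factor 2 comes from log 2 > 1/2. -/
theorem natLog_two_le {n : ℕ} (hn : 2 ≤ n) : (Nat.log 2 n : ℝ) ≤ 2 * Real.log n := by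
  have h1 : ((2 : ℝ) ^ Nat.log 2 n) ≤ n := by exact_mod_cast Nat.pow_log_le_self 2 (by omega)
  have h2 := Real.log_le_log (by positivity) h1
  rw [Real.log_pow] at h2
  have h3 : (0 : ℝ) ≤ Nat.log 2 n := Nat.cast_nonneg _
  nlinarith [Real.log_two_gt_d9]

theorem implementable_bounds {n : ℕ} (hn : 1 ≤ n) {V : QOp (Fin (n + 1))}
    (h : Implementable (Fin 1) (2856 * (Nat.log 2 n + 1) + 8456) (544 * n + 8456) V) :
    ∃ C : QCircuit (Fin (n + 1) ⊕ Fin 1), ImplementsWithDirty C V ∧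
      (C.size : ℝ) ≤ 28336 * (n : ℝ) ∧ (2 ≤ n → (C.depth : ℝ) ≤ 28336 * Real.log (n : ℝ)) := by
  obtain ⟨C, h1, h2, h3⟩ := h
  refine ⟨C, h1, ?_, fun hn2 => ?_⟩
  · have : C.size ≤ 28336 * n := by omega
    exact_mod_cast this
  · have hlog : 1 ≤ Nat.log 2 n := Nat.log_pos (by omega) hn2
    -- The constant 2856 + 8456 = 11312 is absorbed since the logarithm is at least 1, and 2856 +
    -- 11312 = 14168. Doubling for the natural logarithm gives 28336.
    have h4 : C.depth ≤ 14168 * Nat.log 2 n := by omega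
    have h5 : (C.depth : ℝ) ≤ 14168 * (Nat.log 2 n : ℝ) := by exact_mod_cast h4
    linarith [natLog_two_le hn2]

end Involutions

theorem mainTheorem6 :
    ∃ K : ℝ,
      (∀ U : Matrix.unitaryGroup (Fin 2) ℂ, U ^ 2 = 1 → ∀ n : ℕ, 1 ≤ n →
        ∃ C : QCircuit (Fin (n + 1) ⊕ Fin 1),
          ImplementsWithDirty C (controlledGate n (U : Matrix (Fin 2) (Fin 2) ℂ)) ∧
          (C.size : ℝ) ≤ K * (n : ℝ) ∧
          (2 ≤ n → (C.depth : ℝ) ≤ K * Real.log (n : ℝ))) ∧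
      (∀ n : ℕ, 1 ≤ n →
        ∃ C : QCircuit (Fin (n + 1) ⊕ Fin 1),
          ImplementsWithDirty C (toffoliGate n) ∧
          (C.size : ℝ) ≤ K * (n : ℝ) ∧
          (2 ≤ n → (C.depth : ℝ) ≤ K * Real.log (n : ℝ))) := by
  refine ⟨28336, fun U hU n hn => implementable_bounds hn (implementable_controlledGate n U hU),
    fun n hn => implementable_bounds hn
      ((implementable_toffoliGate n).mono (by omega) (by omega))⟩
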